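/- A function $f:X\to Y$ between topological spaces (not necessarily continuous) is *weakly discontinuous* if every subset $A\subseteq X$ contains a relatively open dense subset $U\subseteq A$ such that $f|_U$ is continuous. Spaces $X,Y$ are *weakly homeomorphic* if there is a bijection $f:X\to Y$ such that both $f$ and $f^{-1}$ are weakly discontinuous. A space is *perfectly paracompact* if it is paracompact (Hausdorff included) and each of its open subsets is an $F_\sigma$-set. For a space $X$, the network weight $nw(X)$ is the smallest size of a family $\mathcal N$ of subsets of $X$ such that for every $x\in X$ and every neighborhood $U$ of $x$ there is $N\in\mathcal N$ with $x\in N\subseteq U$; the hereditary Lindelöf number $hl(X)$ is the smallest cardinal $\kappa$ such that each open cover of each subspace of $X$ has a subcover of cardinality $\le\kappa$; the hereditary density $hd(X)$ is the smallest cardinal $\kappa$ such that each subspace of $X$ has a dense subset of cardinality $\le\kappa$. The covering dimension $\dim X$ is $-1$ if $X=\emptyset$; otherwise it is the least integer $n\ge 0$ such that every finite open cover of $X$ has a finite open refinement in which every point lies in at most $n+1$ members, and $\infty$ if there is no such $n$. A space is *analytic* if it is a continuous image of a Polish (separable completely metrizable) space, *$\sigma$-compact* if it is a countable union of compact subsets,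 and *$\sigma$-Polish* if it is a countable union of closed Polish subspaces. **Corollary.** If $X,Y$ are weakly homeomorphic perfectly paracompact spaces, then 1. $nw(X)=nw(Y)$; 2. $hl(X)=hl(Y)$; 3. $hd(X)=hd(Y)$; 4. $\dim X=\dim Y$; 5. $X$ is analytic if and only if $Y$ is analytic; 6. $X$ is $\sigma$-compact if and only if $Y$ is $\sigma$-compact; 7. $X$ is $\sigma$-Polish if and only if $Y$ is $\sigma$-Polish. -/

import Mathlib

open Set
open scoped Topology Cardinal

universe u v

/-- `f` is weakly discontinuous: every subset `A` of `X` contains a relatively open, dense subset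
`U` of `A` such that the restriction of `f` to `U` is continuous. -/
def IsWeaklyDiscontinuous {X : Type u} {Y : Type v} [TopologicalSpace X] [TopologicalSpace Y]
    (f : X → Y) : Prop :=
  ∀ A : Set X, ∃ U ⊆ A, (∃ O : Set X, IsOpen O ∧ U = A ∩ O) ∧ A ⊆ closure U ∧ ContinuousOn f U

/-- There is a bijection `X → Y` that is weakly discontinuous together with its inverse. -/
def WeaklyHomeomorphic (X : Type u) (Y : Type v) [TopologicalSpace X] [TopologicalSpace Y] :
    Prop :=
  ∃ f : X ≃ Y, IsWeaklyDiscontinuous f ∧ IsWeaklyDiscontinuous f.symm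

/-- Perfectly paracompact spaces: paracompact (the Hausdorff axiom is included, as usual) and every
open set is a countable union of closed sets. -/
structure PerfectlyParacompact (X : Type u) [TopologicalSpace X] : Prop where
  t2 : T2Space X
  paracompact : ParacompactSpace X
  open_fsigma : ∀ U : Set X, IsOpen U → ∃ F : ℕ → Set X, (∀ n, IsClosed (F n)) ∧ U = ⋃ n, F n

/-- A family `N` of subsets of `X` is a network. -/
def IsNetwork {X : Type u} [TopologicalSpace X] (N : Set (Set X)) : Prop :=
  ∀ x : X, ∀ U ∈ 𝓝 x, ∃ S ∈ N, x ∈ S ∧ S ⊆ U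

/-- The network weight: the smallest size of a network. -/
noncomputable def networkWeight (X : Type u) [TopologicalSpace X] : Cardinal.{u} :=
  sInf {κ | ∃ N : Set (Set X), IsNetwork N ∧ #N = κ}

/-- The hereditary Lindelöf number: the smallest `κ` such that every cover of a subspace `Z` by
open sets has a subcover of size at most `κ`. -/
noncomputable def hereditaryLindelofNumber (X : Type u) [TopologicalSpace X] : Cardinal.{u} :=
  sInf {κ | ∀ (Z : Set X) (C : Set (Set X)), (∀ U ∈ C, IsOpen U) → Z ⊆ ⋃₀ C →
    ∃ C' ⊆ C, #C' ≤ κ ∧ Z ⊆ ⋃₀ C'}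

/-- The hereditary density: the smallest `κ` such that every subspace `Z` has a dense subset of size
at most `κ`. -/
noncomputable def hereditaryDensity (X : Type u) [TopologicalSpace X] : Cardinal.{u} :=
  sInf {κ | ∀ Z : Set X, ∃ D ⊆ Z, #D ≤ κ ∧ Z ⊆ closure D}

/-- Every finite open cover of `X` has a finite open refinement of order at most `n`, i.e. one such
that every point lies in at most `n + 1` of its members. -/
def CoveringDimLE (X : Type u) [TopologicalSpace X] (n : ℕ) : Prop :=
  ∀ C : Set (Set X), C.Finite → (∀ U ∈ C, IsOpen U) → ⋃₀ C = univ →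
    ∃ R : Set (Set X), R.Finite ∧ (∀ V ∈ R, IsOpen V) ∧ ⋃₀ R = univ ∧
      (∀ V ∈ R, ∃ U ∈ C, V ⊆ U) ∧ ∀ x : X, {V ∈ R | x ∈ V}.encard ≤ n + 1

/-- The covering dimension. The value `⊥` plays the role of `-1`, the dimension of the empty
space, and `⊤` is infinite dimension. -/
noncomputable def coveringDim (X : Type u) [TopologicalSpace X] : WithBot ℕ∞ :=
  sInf {d | (d = ⊥ ∧ IsEmpty X) ∨ ∃ n : ℕ, d = ((n : ℕ∞) : WithBot ℕ∞) ∧ CoveringDimLE X n}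

/-- `X` is a continuous image of a Polish space. Every Polish space has at most continuum many
points, so letting `P` range over `Type` is no restriction. -/
def IsAnalyticSpace (X : Type u) [TopologicalSpace X] : Prop :=
  ∃ (P : Type) (_ : TopologicalSpace P) (_ : PolishSpace P) (g : P → X),
    Continuous g ∧ Function.Surjective g

/-- `X` is a countable union of closed Polish subspaces. -/
def IsSigmaPolish (X : Type u) [TopologicalSpace X] : Prop :=
  ∃ F : ℕ → Set X, (∀ n, IsClosed (F n)) ∧ (∀ n, PolishSpace (F n)) ∧ ⋃ n, F n = univ

open Topology

/-!
In a perfectly paracompact space, the open sets on which a weakly discontinuous map is continuous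
along a countable closed decomposition have a largest member, because locally finite unions of
closed sets glue. Weak discontinuity, applied to the complement of that largest set, forces the
complement to be empty. Intersecting such decompositions for a weak homeomorphism and for its
inverse, `X` becomes a countable union of closed subspaces each of which is a closed subspace of
`Y`, and conversely. All seven properties pass to closed subspaces and to countable closed unions,
except that the cardinal invariants do the latter only above `ℵ₀`; finite spaces are discrete.
-/

section SigmaContinuity

variable {X : Type u} {Y : Type v} [TopologicalSpace X] [TopologicalSpace Y] {f : X → Y}

/-- `f` is σ-continuous on `W`: the set `W` is a countable union of sets that are closed in the
whole space and on each of which `f` is continuous. -/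
def IsSigmaContinuousOn (f : X → Y) (W : Set X) : Prop :=
  ∃ F : ℕ → Set X, (∀ n, IsClosed (F n)) ∧ (∀ n, ContinuousOn f (F n)) ∧ W = ⋃ n, F n

theorem IsSigmaContinuousOn.mono {W F : Set X} (h : IsSigmaContinuousOn f W) (hF : IsClosed F)
    (hFW : F ⊆ W) : IsSigmaContinuousOn f F := by
  obtain ⟨G, hGc, hGf, rfl⟩ := h
  refine ⟨fun n => F ∩ G n, fun n => hF.inter (hGc n),
    fun n => (hGf n).mono inter_subset_right, ?_⟩
  rw [← inter_iUnion, inter_eq_left.2 hFW]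

theorem IsSigmaContinuousOn.iUnion {ι : Type*} [Countable ι] {W : ι → Set X}
    (h : ∀ i, IsSigmaContinuousOn f (W i)) : IsSigmaContinuousOn f (⋃ i, W i) := by
  choose F hFc hFf hF using h
  rcases isEmpty_or_nonempty ι with _ | _
  · exact ⟨fun _ => ∅, fun _ => isClosed_empty, fun _ => continuousOn_empty f, by simp⟩
  · obtain ⟨e, he⟩ := exists_surjective_nat (ι × ℕ)
    refine ⟨fun n => F (e n).1 (e n).2, fun n => hFc _ _, fun n => hFf _ _, ?_⟩
    rw [he.iUnion_comp fun p : ι × ℕ => F p.1 p.2, iUnion_prod']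
    exact iUnion_congr hF

theorem IsSigmaContinuousOn.union {V W : Set X} (hV : IsSigmaContinuousOn f V)
    (hW : IsSigmaContinuousOn f W) : IsSigmaContinuousOn f (V ∪ W) := by
  rw [union_eq_iUnion]
  exact .iUnion (Bool.forall_bool.2 ⟨hW, hV⟩)

theorem IsSigmaContinuousOn.iUnion_of_locallyFinite {ι : Type*} {W : ι → Set X}
    (hW : LocallyFinite W) (h : ∀ i, IsSigmaContinuousOn f (W i)) :
    IsSigmaContinuousOn f (⋃ i, W i) := by
  choose F hFc hFf hF using h
  have hlf : ∀ n, LocallyFinite fun i => F i n := fun n =>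
    hW.subset fun i => (subset_iUnion (F i) n).trans_eq (hF i).symm
  refine ⟨fun n => ⋃ i, F i n, fun n => (hlf n).isClosed_iUnion fun i => hFc i n,
    fun n => (hlf n).continuousOn_iUnion (fun i => hFc i n) fun i => hFf i n, ?_⟩
  rw [iUnion_comm]
  exact iUnion_congr hF

theorem exists_locallyFinite_isClosed_subset [NormalSpace X] [ParacompactSpace X] {ι : Type*}
    {F : Set X} (hF : IsClosed F) {V : ι → Set X} (hV : ∀ i, IsOpen (V i)) (hFV : F ⊆ ⋃ i, V i) :
    ∃ K : ι → Set X, LocallyFinite K ∧ (∀ i, IsClosed (K i)) ∧ (∀ i, K i ⊆ V i) ∧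
      F ⊆ ⋃ i, K i := by
  obtain ⟨W, hWo, hFW, hWl, hWV⟩ := precise_refinement_set hF V hV hFV
  obtain ⟨K, hFK, hKc, hKW⟩ :=
    exists_subset_iUnion_closed_subset hF hWo (fun x _ => hWl.point_finite x) hFW
  exact ⟨K, hWl.subset hKW, hKc, fun i => (hKW i).trans (hWV i), hFK⟩

theorem PerfectlyParacompact.isSigmaContinuousOn_iUnion (hX : PerfectlyParacompact X) {ι : Type*}
    {V : ι → Set X} (hVo : ∀ i, IsOpen (V i)) (hV : ∀ i, IsSigmaContinuousOn f (V i)) :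
    IsSigmaContinuousOn f (⋃ i, V i) := by
  have := hX.t2
  have := hX.paracompact
  obtain ⟨F, hFc, hF⟩ := hX.open_fsigma _ (isOpen_iUnion hVo)
  choose K hKl hKc hKV hFK using fun n =>
    exists_locallyFinite_isClosed_subset (hFc n) hVo (hF ▸ subset_iUnion F n)
  have hVK : ⋃ i, V i = ⋃ n, ⋃ i, K n i :=
    (hF.trans_subset (iUnion_mono hFK)).antisymm (iUnion_subset fun n => iUnion_mono (hKV n))
  rw [hVK]
  exact .iUnion fun n => .iUnion_of_locallyFinite (hKl n) fun i => (hV i).mono (hKc n i) (hKV n i)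

theorem PerfectlyParacompact.isSigmaContinuousOn_inter (hX : PerfectlyParacompact X) {F O : Set X}
    (hF : IsClosed F) (hO : IsOpen O) (hf : ContinuousOn f (F ∩ O)) :
    IsSigmaContinuousOn f (F ∩ O) := by
  obtain ⟨G, hGc, rfl⟩ := hX.open_fsigma O hO
  exact ⟨fun n => F ∩ G n, fun n => hF.inter (hGc n),
    fun n => hf.mono (inter_subset_inter_right F (subset_iUnion G n)), inter_iUnion F G⟩

theorem IsWeaklyDiscontinuous.isSigmaContinuousOn_univ (hX : PerfectlyParacompact X)
    (hf : IsWeaklyDiscontinuous f) : IsSigmaContinuousOn f univ := by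
  let C : Set (Set X) := {V | IsOpen V ∧ IsSigmaContinuousOn f V}
  have hCo : IsOpen (⋃₀ C) := isOpen_sUnion fun V hV => hV.1
  have hCf : IsSigmaContinuousOn f (⋃₀ C) := by
    rw [sUnion_eq_iUnion]
    exact hX.isSigmaContinuousOn_iUnion (fun V : C => V.2.1) fun V => V.2.2
  obtain ⟨_, -, ⟨O, hO, rfl⟩, hdense, hfO⟩ := hf (⋃₀ C)ᶜ
  have hOC : O ⊆ ⋃₀ C := by
    have hmem : ⋃₀ C ∪ O ∈ C := by
      refine ⟨hCo.union hO, ?_⟩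
      have := hCf.union (hX.isSigmaContinuousOn_inter hCo.isClosed_compl hO hfO)
      rwa [union_inter_distrib_left, union_compl_self, univ_inter] at this
    exact subset_union_right.trans (subset_sUnion_of_mem hmem)
  have hempty : (⋃₀ C)ᶜ = ∅ := by
    rw [(disjoint_compl_left_iff_subset.2 hOC).inter_eq, closure_empty] at hdense
    exact subset_empty_iff.1 hdense
  rwa [← compl_empty_iff.1 hempty]

end SigmaContinuity

/-- `X` has a countable cover by closed subspaces each of which is homeomorphic to a closed
subspace of `Y`. A property passes along this relation from `Y` to `X` as soon as it is inherited by
closed subspaces and by countable closed unions. -/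
def IsSigmaClosedEmbeddable (X : Type u) (Y : Type v) [TopologicalSpace X] [TopologicalSpace Y] :
    Prop :=
  ∃ A : ℕ → Set X, (∀ n, IsClosed (A n)) ∧ ⋃ n, A n = univ ∧
    ∀ n, ∃ e : A n → Y, IsClosedEmbedding e

section WeakHomeomorphism

variable {X : Type u} {Y : Type v} [TopologicalSpace X] [TopologicalSpace Y]

theorem isClosedEmbedding_domRestrict_inter_preimage {f : X ≃ Y} {F : Set X} {G : Set Y}
    (hF : IsClosed F) (hG : IsClosed G) (hf : ContinuousOn f F) (hg : ContinuousOn f.symm G) :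
    IsClosedEmbedding ((F ∩ f ⁻¹' G).domRestrict f) := by
  have hclosed : IsClosed (F ∩ f ⁻¹' G) := hf.preimage_isClosed_of_isClosed hF hG
  refine .of_continuous_injective_isClosedMap (hf.mono inter_subset_left).domRestrict
    f.injective.injOn.injective fun S hS => ?_
  have himage : (F ∩ f ⁻¹' G).domRestrict f '' S = G ∩ f.symm ⁻¹' ((↑) '' S) := by
    rw [← f.image_eq_preimage_symm, image_image]
    refine (inter_eq_right.2 ?_).symm
    rintro _ ⟨x, -, rfl⟩
    exact x.2.2
  rw [himage]
  exact hg.preimage_isClosed_of_isClosed hG (hclosed.isClosedMap_subtype_val S hS)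

theorem WeaklyHomeomorphic.symm (h : WeaklyHomeomorphic X Y) : WeaklyHomeomorphic Y X :=
  h.imp' Equiv.symm fun _ hf => hf.symm

theorem WeaklyHomeomorphic.isSigmaClosedEmbeddable (hX : PerfectlyParacompact X)
    (hY : PerfectlyParacompact Y) (h : WeaklyHomeomorphic X Y) : IsSigmaClosedEmbeddable X Y := by
  obtain ⟨f, hf, hg⟩ := h
  obtain ⟨F, hFc, hFf, hF⟩ := hf.isSigmaContinuousOn_univ hX
  obtain ⟨G, hGc, hGg, hG⟩ := hg.isSigmaContinuousOn_univ hY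
  refine ⟨fun n => F n.unpair.1 ∩ f ⁻¹' G n.unpair.2,
    fun n => (hFf _).preimage_isClosed_of_isClosed (hFc _) (hGc _), ?_, fun n =>
    ⟨_, isClosedEmbedding_domRestrict_inter_preimage (hFc _) (hGc _) (hFf _) (hGg _)⟩⟩
  rw [iUnion_unpair fun i j => F i ∩ f ⁻¹' G j]
  simp only [← inter_iUnion, ← preimage_iUnion, ← hG, preimage_univ, inter_univ, ← hF]

end WeakHomeomorphism

section CardinalInvariants

variable {X : Type u} {Y : Type v} [TopologicalSpace X] [TopologicalSpace Y]

theorem mk_iUnion_le_of_countable {α : Type u} {ι : Type*} [Countable ι] {S : ι → Set α}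
    {κ : Cardinal.{u}} (hκ : ℵ₀ ≤ κ) (hS : ∀ i, #(S i) ≤ κ) : #(⋃ i, S i) ≤ κ := by
  rw [← Cardinal.lift_le]
  calc Cardinal.lift #(⋃ i, S i) ≤ Cardinal.lift #ι * ⨆ i, Cardinal.lift #(S i) :=
        Cardinal.mk_iUnion_le_lift S
    _ ≤ ℵ₀ * Cardinal.lift κ := by
        gcongr
        · exact Cardinal.lift_le_aleph0.2 Cardinal.mk_le_aleph0
        · exact ciSup_le' fun i => Cardinal.lift_le.2 (hS i)
    _ = Cardinal.lift κ := Cardinal.aleph0_mul_eq (Cardinal.aleph0_le_lift.2 hκ)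

theorem lift_le_of_forall_lift_eq {a : Cardinal.{u}} {κ : Cardinal.{max u v}}
    (h : ∀ c, Cardinal.lift.{v} c = κ → a ≤ c) : Cardinal.lift.{v} a ≤ κ := by
  by_contra! hlt
  obtain ⟨c, rfl⟩ := Cardinal.mem_range_lift_of_le hlt.le
  exact (Cardinal.lift_lt.1 hlt).not_ge (h c rfl)

theorem lift_le_lift_of_forall_aleph0_le {ι : Type*} {a : Cardinal.{u}} {b : Cardinal.{v}}
    {c : ι → Cardinal.{u}} (ha : ∀ κ, ℵ₀ ≤ κ → (∀ i, c i ≤ κ) → a ≤ κ) (hb : ℵ₀ ≤ b)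
    (hc : ∀ i, Cardinal.lift.{v} (c i) ≤ Cardinal.lift.{u} b) :
    Cardinal.lift.{v} a ≤ Cardinal.lift.{u} b := by
  refine lift_le_of_forall_lift_eq fun κ hκ => ha κ ?_ fun i => ?_
  · rwa [← Cardinal.aleph0_le_lift, hκ, Cardinal.aleph0_le_lift]
  · rw [← Cardinal.lift_le, hκ]
    exact hc i

theorem isInducing_of_injective_of_finite [T1Space X] [T1Space Y] [Finite Y] {f : X → Y}
    (hf : Function.Injective f) : IsInducing f := by
  have := Finite.of_injective f hf
  exact (IsClosedEmbedding.of_continuous_injective_isClosedMap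
    continuous_of_discreteTopology hf fun _ _ => isClosed_discrete _).isInducing

theorem exists_isNetwork_mk_eq_networkWeight (X : Type u) [TopologicalSpace X] :
    ∃ N : Set (Set X), IsNetwork N ∧ #N = networkWeight X :=
  csInf_mem (s := {κ | ∃ N : Set (Set X), IsNetwork N ∧ #N = κ})
    ⟨_, univ, fun _ U hU => ⟨U, mem_univ U, mem_of_mem_nhds hU, Subset.rfl⟩, rfl⟩

theorem IsNetwork.networkWeight_le {N : Set (Set X)} (hN : IsNetwork N) : networkWeight X ≤ #N :=
  csInf_le' ⟨N, hN, rfl⟩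

theorem IsNetwork.inseparable {N : Set (Set X)} (hN : IsNetwork N) {x y : X}
    (h : ∀ S ∈ N, x ∈ S ↔ y ∈ S) : Inseparable x y := by
  refine inseparable_iff_forall_isOpen.2 fun U hU => ⟨fun hx => ?_, fun hy => ?_⟩
  · obtain ⟨S, hS, hxS, hSU⟩ := hN x U (hU.mem_nhds hx)
    exact hSU ((h S hS).1 hxS)
  · obtain ⟨S, hS, hyS, hSU⟩ := hN y U (hU.mem_nhds hy)
    exact hSU ((h S hS).2 hyS)

theorem aleph0_le_networkWeight (X : Type u) [TopologicalSpace X] [T0Space X] [Infinite X] :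
    ℵ₀ ≤ networkWeight X := by
  obtain ⟨N, hN, hNκ⟩ := exists_isNetwork_mk_eq_networkWeight X
  have hinj : Function.Injective fun x : X => {S : N | x ∈ (S : Set X)} := fun x y hxy =>
    (hN.inseparable fun S hS => Set.ext_iff.1 hxy ⟨S, hS⟩).eq
  rw [← hNκ, Cardinal.aleph0_le_mk_iff]
  by_contra hfin
  rw [not_infinite_iff_finite] at hfin
  exact not_finite_iff_infinite.2 ‹_› (Finite.of_injective _ hinj)

theorem lift_networkWeight_le_of_isInducing {e : X → Y} (he : IsInducing e) :
    Cardinal.lift.{v} (networkWeight X) ≤ Cardinal.lift.{u} (networkWeight Y) := by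
  obtain ⟨N, hN, hNκ⟩ := exists_isNetwork_mk_eq_networkWeight Y
  have hNX : IsNetwork (preimage e '' N) := by
    intro x U hU
    obtain ⟨V, hV, hVU⟩ := he.nhds_eq_comap x ▸ hU
    obtain ⟨S, hS, hxS, hSV⟩ := hN (e x) V hV
    exact ⟨e ⁻¹' S, mem_image_of_mem _ hS, hxS, (preimage_mono hSV).trans hVU⟩
  rw [← hNκ]
  exact (Cardinal.lift_le.2 hNX.networkWeight_le).trans Cardinal.mk_image_le_lift

theorem networkWeight_le_of_iUnion {ι : Type*} [Countable ι] {A : ι → Set X}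
    (hA : ⋃ i, A i = univ) {κ : Cardinal.{u}} (hκ : ℵ₀ ≤ κ) (h : ∀ i, networkWeight (A i) ≤ κ) :
    networkWeight X ≤ κ := by
  choose N hN hNκ using fun i => exists_isNetwork_mk_eq_networkWeight (A i)
  have hNX : IsNetwork (⋃ i, image (↑) '' N i : Set (Set X)) := by
    intro x U hU
    obtain ⟨i, hi⟩ := mem_iUnion.1 (hA ▸ mem_univ x)
    obtain ⟨S, hS, hxS, hSU⟩ := hN i ⟨x, hi⟩ _ (preimage_coe_mem_nhds_subtype.2
      (mem_nhdsWithin_of_mem_nhds hU))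
    exact ⟨_, mem_iUnion.2 ⟨i, mem_image_of_mem _ hS⟩, mem_image_of_mem _ hxS,
      image_subset_iff.2 hSU⟩
  exact hNX.networkWeight_le.trans <| mk_iUnion_le_of_countable hκ fun i =>
    Cardinal.mk_image_le.trans ((hNκ i).trans_le (h i))

theorem IsSigmaClosedEmbeddable.lift_networkWeight_le [T1Space X] [T1Space Y]
    (h : IsSigmaClosedEmbeddable X Y) {f : X → Y} (hf : Function.Injective f) :
    Cardinal.lift.{v} (networkWeight X) ≤ Cardinal.lift.{u} (networkWeight Y) := by
  cases finite_or_infinite Y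
  · exact lift_networkWeight_le_of_isInducing (isInducing_of_injective_of_finite hf)
  · obtain ⟨A, -, hA, he⟩ := h
    choose e he using he
    exact lift_le_lift_of_forall_aleph0_le (fun κ => networkWeight_le_of_iUnion hA)
      (aleph0_le_networkWeight Y) fun n => lift_networkWeight_le_of_isInducing (he n).isInducing

theorem exists_subcover_mk_le_hereditaryLindelofNumber (Z : Set X) {C : Set (Set X)}
    (hC : ∀ U ∈ C, IsOpen U) (hZ : Z ⊆ ⋃₀ C) :
    ∃ C' ⊆ C, #C' ≤ hereditaryLindelofNumber X ∧ Z ⊆ ⋃₀ C' :=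
  csInf_mem (s := {κ | ∀ (Z : Set X) (C : Set (Set X)), (∀ U ∈ C, IsOpen U) → Z ⊆ ⋃₀ C →
    ∃ C' ⊆ C, #C' ≤ κ ∧ Z ⊆ ⋃₀ C'})
    ⟨#(Set X), fun _ C _ hZ => ⟨C, Subset.rfl, Cardinal.mk_set_le C, hZ⟩⟩ Z C hC hZ

theorem lift_hereditaryLindelofNumber_le {κ : Cardinal.{max u v}}
    (h : ∀ (Z : Set X) (C : Set (Set X)), (∀ U ∈ C, IsOpen U) → Z ⊆ ⋃₀ C →
      ∃ C' ⊆ C, Cardinal.lift.{v} #C' ≤ κ ∧ Z ⊆ ⋃₀ C') :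
    Cardinal.lift.{v} (hereditaryLindelofNumber X) ≤ κ := by
  refine lift_le_of_forall_lift_eq fun c hc => csInf_le' ?_
  simp only [← hc, Cardinal.lift_le] at h
  exact h

theorem lift_hereditaryLindelofNumber_le_of_isInducing {e : X → Y} (he : IsInducing e) :
    Cardinal.lift.{v} (hereditaryLindelofNumber X) ≤
      Cardinal.lift.{u} (hereditaryLindelofNumber Y) := by
  refine lift_hereditaryLindelofNumber_le fun Z C hC hZ => ?_
  obtain ⟨D, hDC, hDκ, hD⟩ := exists_subcover_mk_le_hereditaryLindelofNumber (e '' Z)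
    (C := {V | IsOpen V ∧ e ⁻¹' V ∈ C}) (fun V hV => hV.1) (by
      rintro _ ⟨x, hx, rfl⟩
      obtain ⟨U, hU, hxU⟩ := hZ hx
      obtain ⟨V, hV, rfl⟩ := he.isOpen_iff.1 (hC U hU)
      exact ⟨V, ⟨hV, hU⟩, hxU⟩)
  refine ⟨preimage e '' D, image_subset_iff.2 fun V hV => (hDC hV).2,
    Cardinal.mk_image_le_lift.trans (Cardinal.lift_le.2 hDκ), fun x hx => ?_⟩
  obtain ⟨V, hV, hxV⟩ := hD (mem_image_of_mem e hx)
  exact ⟨e ⁻¹' V, mem_image_of_mem _ hV, hxV⟩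

theorem exists_subcover_mk_le_hereditaryLindelofNumber_coe {S Z : Set X} (hZS : Z ⊆ S)
    {C : Set (Set X)} (hC : ∀ U ∈ C, IsOpen U) (hZ : Z ⊆ ⋃₀ C) :
    ∃ C' ⊆ C, #C' ≤ hereditaryLindelofNumber S ∧ Z ⊆ ⋃₀ C' := by
  obtain ⟨D, hDC, hDκ, hD⟩ := exists_subcover_mk_le_hereditaryLindelofNumber
    ((↑) ⁻¹' Z : Set S) (C := preimage (↑) '' C)
    (forall_mem_image.2 fun U hU => (hC U hU).preimage continuous_subtype_val) (by
      rw [sUnion_image, ← preimage_iUnion₂, ← sUnion_eq_biUnion]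
      exact preimage_mono hZ)
  obtain ⟨C', hC'C, hC'⟩ := SurjOn.exists_bijOn_subset hDC
  refine ⟨C', hC'C, (Cardinal.mk_congr (hC'.equiv _)).trans_le hDκ, fun x hx => ?_⟩
  obtain ⟨_, hV, hxV⟩ := hD (show ⟨x, hZS hx⟩ ∈ ((↑) ⁻¹' Z : Set S) from hx)
  obtain ⟨U, hU, rfl⟩ := hC'.surjOn hV
  exact ⟨U, hU, hxV⟩

theorem hereditaryLindelofNumber_le_of_iUnion {ι : Type*} [Countable ι] {A : ι → Set X}
    (hA : ⋃ i, A i = univ) {κ : Cardinal.{u}} (hκ : ℵ₀ ≤ κ)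
    (h : ∀ i, hereditaryLindelofNumber (A i) ≤ κ) : hereditaryLindelofNumber X ≤ κ := by
  refine csInf_le' fun Z C hC hZ => ?_
  choose D hDC hDκ hD using fun i => exists_subcover_mk_le_hereditaryLindelofNumber_coe
    (inter_subset_right : Z ∩ A i ⊆ A i) hC (inter_subset_left.trans hZ)
  refine ⟨⋃ i, D i, iUnion_subset hDC,
    mk_iUnion_le_of_countable hκ fun i => (hDκ i).trans (h i), ?_⟩
  rw [← inter_univ Z, ← hA, inter_iUnion]
  exact iUnion_subset fun i => (hD i).trans (sUnion_mono (subset_iUnion D i))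

theorem aleph0_le_hereditaryLindelofNumber (X : Type u) [TopologicalSpace X] [T2Space X]
    [Infinite X] : ℵ₀ ≤ hereditaryLindelofNumber X := by
  obtain ⟨U, hUi, hUo, hUd⟩ := exists_seq_infinite_isOpen_pairwise_disjoint X
  obtain ⟨C, hCU, hCκ, hC⟩ := exists_subcover_mk_le_hereditaryLindelofNumber (⋃ n, U n)
    (forall_mem_range.2 hUo) (sUnion_range U).ge
  have hmem : ∀ n, U n ∈ C := by
    intro n
    obtain ⟨x, hx⟩ := (hUi n).nonempty
    obtain ⟨V, hV, hxV⟩ := hC (mem_iUnion.2 ⟨n, hx⟩)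
    obtain ⟨m, rfl⟩ := hCU hV
    rwa [hUd.eq (not_disjoint_iff.2 ⟨x, hx, hxV⟩)]
  have hinj : Function.Injective U := by
    intro n m hnm
    obtain ⟨x, hx⟩ := (hUi n).nonempty
    exact hUd.eq (not_disjoint_iff.2 ⟨x, hx, hnm ▸ hx⟩)
  refine le_trans ?_ hCκ
  rw [Cardinal.aleph0_le_mk_iff]
  exact Infinite.of_injective (codRestrict U C hmem) (hinj.codRestrict hmem)

theorem IsSigmaClosedEmbeddable.lift_hereditaryLindelofNumber_le [T1Space X] [T2Space Y]
    (h : IsSigmaClosedEmbeddable X Y) {f : X → Y} (hf : Function.Injective f) :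
    Cardinal.lift.{v} (hereditaryLindelofNumber X) ≤
      Cardinal.lift.{u} (hereditaryLindelofNumber Y) := by
  cases finite_or_infinite Y
  · exact lift_hereditaryLindelofNumber_le_of_isInducing (isInducing_of_injective_of_finite hf)
  · obtain ⟨A, -, hA, he⟩ := h
    choose e he using he
    exact lift_le_lift_of_forall_aleph0_le (fun κ => hereditaryLindelofNumber_le_of_iUnion hA)
      (aleph0_le_hereditaryLindelofNumber Y)
      fun n => lift_hereditaryLindelofNumber_le_of_isInducing (he n).isInducing

theorem exists_dense_mk_le_hereditaryDensity (Z : Set X) :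
    ∃ D ⊆ Z, #D ≤ hereditaryDensity X ∧ Z ⊆ closure D :=
  csInf_mem (s := {κ | ∀ Z : Set X, ∃ D ⊆ Z, #D ≤ κ ∧ Z ⊆ closure D})
    ⟨#X, fun Z => ⟨Z, Subset.rfl, Cardinal.mk_set_le Z, subset_closure⟩⟩ Z

theorem lift_hereditaryDensity_le {κ : Cardinal.{max u v}}
    (h : ∀ Z : Set X, ∃ D ⊆ Z, Cardinal.lift.{v} #D ≤ κ ∧ Z ⊆ closure D) :
    Cardinal.lift.{v} (hereditaryDensity X) ≤ κ := by
  refine lift_le_of_forall_lift_eq fun c hc => csInf_le' ?_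
  simp only [← hc, Cardinal.lift_le] at h
  exact h

theorem lift_hereditaryDensity_le_of_isInducing {e : X → Y} (he : IsInducing e) :
    Cardinal.lift.{v} (hereditaryDensity X) ≤ Cardinal.lift.{u} (hereditaryDensity Y) := by
  refine lift_hereditaryDensity_le fun Z => ?_
  obtain ⟨D, hDZ, hDκ, hD⟩ := exists_dense_mk_le_hereditaryDensity (e '' Z)
  obtain ⟨D', hD'Z, hD'⟩ := SurjOn.exists_bijOn_subset hDZ
  refine ⟨D', hD'Z, ?_, ?_⟩
  · exact (Cardinal.lift_mk_eq'.2 ⟨hD'.equiv _⟩).trans_le (Cardinal.lift_le.2 hDκ)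
  · rw [he.closure_eq_preimage_closure_image, hD'.image_eq]
    exact image_subset_iff.1 hD

theorem exists_dense_mk_le_hereditaryDensity_coe {S Z : Set X} (hZS : Z ⊆ S) :
    ∃ D ⊆ Z, #D ≤ hereditaryDensity S ∧ Z ⊆ closure D := by
  obtain ⟨D, hDZ, hDκ, hD⟩ := exists_dense_mk_le_hereditaryDensity ((↑) ⁻¹' Z : Set S)
  refine ⟨(↑) '' D, image_subset_iff.2 hDZ, Cardinal.mk_image_le.trans hDκ, fun x hx => ?_⟩
  exact closure_subtype.1 (hD (show ⟨x, hZS hx⟩ ∈ ((↑) ⁻¹' Z : Set S) from hx))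

theorem hereditaryDensity_le_of_iUnion {ι : Type*} [Countable ι] {A : ι → Set X}
    (hA : ⋃ i, A i = univ) {κ : Cardinal.{u}} (hκ : ℵ₀ ≤ κ)
    (h : ∀ i, hereditaryDensity (A i) ≤ κ) : hereditaryDensity X ≤ κ := by
  refine csInf_le' fun Z => ?_
  choose D hDZ hDκ hD using fun i => exists_dense_mk_le_hereditaryDensity_coe
    (inter_subset_right : Z ∩ A i ⊆ A i)
  refine ⟨⋃ i, D i, iUnion_subset fun i => (hDZ i).trans inter_subset_left,
    mk_iUnion_le_of_countable hκ fun i => (hDκ i).trans (h i), ?_⟩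
  rw [← inter_univ Z, ← hA, inter_iUnion]
  exact iUnion_subset fun i => (hD i).trans (closure_mono (subset_iUnion D i))

theorem aleph0_le_hereditaryDensity (X : Type u) [TopologicalSpace X] [T2Space X] [Infinite X] :
    ℵ₀ ≤ hereditaryDensity X := by
  obtain ⟨U, hUi, hUo, hUd⟩ := exists_seq_infinite_isOpen_pairwise_disjoint X
  obtain ⟨D, -, hDκ, hD⟩ := exists_dense_mk_le_hereditaryDensity (⋃ n, U n)
  have hmeet : ∀ n, (U n ∩ D).Nonempty := by
    intro n
    obtain ⟨x, hx⟩ := (hUi n).nonempty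
    exact mem_closure_iff.1 (hD (mem_iUnion.2 ⟨n, hx⟩)) _ (hUo n) hx
  choose d hdU hdD using hmeet
  have hinj : Function.Injective d := fun n m hnm =>
    hUd.eq (not_disjoint_iff.2 ⟨d n, hdU n, hnm ▸ hdU m⟩)
  refine le_trans ?_ hDκ
  rw [Cardinal.aleph0_le_mk_iff]
  exact Infinite.of_injective (codRestrict d D hdD) (hinj.codRestrict hdD)

theorem IsSigmaClosedEmbeddable.lift_hereditaryDensity_le [T1Space X] [T2Space Y]
    (h : IsSigmaClosedEmbeddable X Y) {f : X → Y} (hf : Function.Injective f) :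
    Cardinal.lift.{v} (hereditaryDensity X) ≤ Cardinal.lift.{u} (hereditaryDensity Y) := by
  cases finite_or_infinite Y
  · exact lift_hereditaryDensity_le_of_isInducing (isInducing_of_injective_of_finite hf)
  · obtain ⟨A, -, hA, he⟩ := h
    choose e he using he
    exact lift_le_lift_of_forall_aleph0_le (fun κ => hereditaryDensity_le_of_iUnion hA)
      (aleph0_le_hereditaryDensity Y)
      fun n => lift_hereditaryDensity_le_of_isInducing (he n).isInducing

end CardinalInvariants

section DescriptiveProperties

variable {X : Type u} {Y : Type v} [TopologicalSpace X] [TopologicalSpace Y]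

theorem isAnalyticSpace_of_isClosedEmbedding {e : X → Y} (he : IsClosedEmbedding e)
    (hY : IsAnalyticSpace Y) : IsAnalyticSpace X := by
  obtain ⟨P, _, _, g, hg, hsurj⟩ := hY
  have := (he.isClosed_range.preimage hg).polishSpace
  exact ⟨g ⁻¹' range e, inferInstance, inferInstance,
    he.toHomeomorph.symm ∘ (range e).restrictPreimage g,
    he.toHomeomorph.symm.continuous.comp hg.restrictPreimage,
    he.toHomeomorph.symm.surjective.comp (hsurj.restrictPreimage _)⟩

theorem isAnalyticSpace_of_iUnion {A : ℕ → Set X} (hA : ⋃ n, A n = univ)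
    (h : ∀ n, IsAnalyticSpace (A n)) : IsAnalyticSpace X := by
  choose P _ _ g hg hsurj using h
  refine ⟨Σ n, P n, inferInstance, inferInstance, fun p => g p.1 p.2,
    continuous_sigma fun n => continuous_subtype_val.comp (hg n), fun x => ?_⟩
  obtain ⟨n, hn⟩ := mem_iUnion.1 (hA ▸ mem_univ x)
  obtain ⟨p, hp⟩ := hsurj n ⟨x, hn⟩
  exact ⟨⟨n, p⟩, congrArg Subtype.val hp⟩

theorem IsSigmaClosedEmbeddable.isAnalyticSpace (h : IsSigmaClosedEmbeddable X Y)
    (hY : IsAnalyticSpace Y) : IsAnalyticSpace X := by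
  obtain ⟨A, -, hA, he⟩ := h
  exact isAnalyticSpace_of_iUnion hA fun n =>
    (he n).elim fun _ hen => isAnalyticSpace_of_isClosedEmbedding hen hY

theorem IsSigmaClosedEmbeddable.sigmaCompactSpace [SigmaCompactSpace Y]
    (h : IsSigmaClosedEmbeddable X Y) : SigmaCompactSpace X := by
  obtain ⟨A, -, hA, he⟩ := h
  rw [← isSigmaCompact_univ_iff, ← hA]
  refine isSigmaCompact_iUnion A fun n => isSigmaCompact_iff_sigmaCompactSpace.2 ?_
  exact (he n).elim fun _ hen => hen.sigmaCompactSpace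

theorem isSigmaPolish_of_isClosedEmbedding {e : X → Y} (he : IsClosedEmbedding e)
    (hY : IsSigmaPolish Y) : IsSigmaPolish X := by
  obtain ⟨F, hFc, hFp, hF⟩ := hY
  refine ⟨fun n => e ⁻¹' F n, fun n => (hFc n).preimage he.continuous, fun n => ?_, ?_⟩
  · have := hFp n
    exact (he.restrictPreimage (F n)).polishSpace
  · rw [← preimage_iUnion, hF, preimage_univ]

theorem isSigmaPolish_of_iUnion {A : ℕ → Set X} (hAc : ∀ n, IsClosed (A n))
    (hA : ⋃ n, A n = univ) (h : ∀ n, IsSigmaPolish (A n)) : IsSigmaPolish X := by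
  choose F hFc hFp hF using h
  refine ⟨fun n => (↑) '' F n.unpair.1 n.unpair.2,
    fun n => (hAc _).isClosedMap_subtype_val _ (hFc _ _), fun n => ?_, ?_⟩
  · have := hFp n.unpair.1 n.unpair.2
    exact (IsEmbedding.subtypeVal.homeomorphImage _).symm.isClosedEmbedding.polishSpace
  · rw [iUnion_unpair fun i j => ((↑) '' F i j : Set X)]
    simp only [← image_iUnion, hF, image_univ, Subtype.range_coe, hA]

theorem IsSigmaClosedEmbeddable.isSigmaPolish (h : IsSigmaClosedEmbeddable X Y)
    (hY : IsSigmaPolish Y) : IsSigmaPolish X := by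
  obtain ⟨A, hAc, hA, he⟩ := h
  exact isSigmaPolish_of_iUnion hAc hA fun n =>
    (he n).elim fun _ hen => isSigmaPolish_of_isClosedEmbedding hen hY

end DescriptiveProperties

section CoveringDimension

variable {X : Type u} {Y : Type v} [TopologicalSpace X] [TopologicalSpace Y] {n : ℕ}

theorem CoveringDimLE.exists_shrinking (h : CoveringDimLE X n) {ι : Type*} [Finite ι]
    {U : ι → Set X} (hUo : ∀ j, IsOpen (U j)) (hU : ⋃ j, U j = univ) :
    ∃ V : ι → Set X, (∀ j, IsOpen (V j)) ∧ (∀ j, V j ⊆ U j) ∧ ⋃ j, V j = univ ∧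
      ∀ x, {j | x ∈ V j}.encard ≤ n + 1 := by
  rcases isEmpty_or_nonempty ι with _ | _
  · exact ⟨U, hUo, fun _ => Subset.rfl, hU, fun x => by simp [eq_empty_of_isEmpty]⟩
  obtain ⟨R, -, hRo, hR, hRU, hord⟩ :=
    h (range U) (finite_range U) (forall_mem_range.2 hUo) ((sUnion_range U).trans hU)
  simp only [exists_range_iff] at hRU
  choose! r hr using hRU
  refine ⟨fun j => ⋃₀ {V ∈ R | r V = j}, fun j => isOpen_sUnion fun V hV => hRo V hV.1, ?_, ?_,
    fun x => ?_⟩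
  · rintro _ x ⟨V, ⟨hV, rfl⟩, hxV⟩
    exact hr V hV hxV
  · refine eq_univ_of_forall fun x => ?_
    obtain ⟨V, hV, hxV⟩ := hR.ge (mem_univ x)
    exact mem_iUnion.2 ⟨r V, V, ⟨hV, rfl⟩, hxV⟩
  · have himage : {j | x ∈ ⋃₀ {V ∈ R | r V = j}} ⊆ r '' {V ∈ R | x ∈ V} := by
      rintro _ ⟨V, ⟨hV, rfl⟩, hxV⟩
      exact mem_image_of_mem r ⟨hV, hxV⟩
    exact (encard_le_encard himage).trans ((encard_image_le r _).trans (hord x))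

theorem coveringDimLE_of_forall_exists_shrinking
    (h : ∀ (ι : Type u) [Finite ι] (U : ι → Set X), (∀ j, IsOpen (U j)) → ⋃ j, U j = univ →
      ∃ V : ι → Set X, (∀ j, IsOpen (V j)) ∧ (∀ j, V j ⊆ U j) ∧ ⋃ j, V j = univ ∧
        ∀ x, {j | x ∈ V j}.encard ≤ n + 1) : CoveringDimLE X n := by
  intro C hfin hCo hCU
  have : Finite C := hfin
  obtain ⟨V, hVo, hVU, hV, hord⟩ :=
    h C (↑) (fun U => hCo U U.2) (by rw [← sUnion_eq_iUnion, hCU])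
  refine ⟨range V, finite_range V, forall_mem_range.2 hVo, (sUnion_range V).trans hV,
    forall_mem_range.2 fun j => ⟨j, j.2, hVU j⟩, fun x => ?_⟩
  have himage : {W ∈ range V | x ∈ W} ⊆ V '' {j | x ∈ V j} := by
    rintro _ ⟨⟨j, rfl⟩, hx⟩
    exact mem_image_of_mem V hx
  exact (encard_le_encard himage).trans ((encard_image_le V _).trans (hord x))

theorem CoveringDimLE.of_isClosedEmbedding (h : CoveringDimLE Y n) {e : X → Y}
    (he : IsClosedEmbedding e) : CoveringDimLE X n := by
  refine coveringDimLE_of_forall_exists_shrinking fun ι _ U hUo hU => ?_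
  choose W hWo hWU using fun j => he.isOpen_iff.1 (hUo j)
  let W' : Option ι → Set Y := fun o => o.elim (range e)ᶜ W
  have hW'o : ∀ o, IsOpen (W' o) := Option.forall.2 ⟨he.isClosed_range.isOpen_compl, hWo⟩
  have hW' : ⋃ o, W' o = univ := by
    rw [iUnion_option, ← compl_subset_iff_union]
    intro y hy
    obtain ⟨x, rfl⟩ := not_not.1 hy
    obtain ⟨j, hj⟩ := mem_iUnion.1 (hU ▸ mem_univ x)
    exact mem_iUnion.2 ⟨j, (hWU j).ge hj⟩
  obtain ⟨V, hVo, hVW, hV, hord⟩ := h.exists_shrinking hW'o hW'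
  refine ⟨fun j => e ⁻¹' V (some j), fun j => (hVo _).preimage he.continuous,
    fun j => (preimage_mono (hVW (some j))).trans_eq (hWU j), eq_univ_of_forall fun x => ?_,
    fun x => ?_⟩
  · obtain ⟨_ | j, hj⟩ := mem_iUnion.1 (hV ▸ mem_univ (e x))
    · exact absurd (mem_range_self x) (hVW none hj)
    · exact mem_iUnion.2 ⟨j, hj⟩
  · refine le_trans ?_ (hord (e x))
    rw [← (Option.some_injective ι).encard_image]
    exact encard_le_encard (image_subset_iff.2 Subset.rfl)

theorem CoveringDimLE.exists_closure_shrinking [NormalSpace X] {F : Set X}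
    (h : CoveringDimLE F n) (hF : IsClosed F) {ι : Type*} [Finite ι] {U : ι → Set X}
    (hUo : ∀ j, IsOpen (U j)) (hU : ⋃ j, U j = univ) :
    ∃ V : ι → Set X, (∀ j, IsOpen (V j)) ∧ ⋃ j, V j = univ ∧ (∀ j, closure (V j) ⊆ U j) ∧
      ∀ x ∈ F, {j | x ∈ closure (V j)}.encard ≤ n + 1 := by
  obtain ⟨W', hW'o, hWU, hW, hord⟩ := h.exists_shrinking
    (fun j => (hUo j).preimage continuous_subtype_val)
    (by rw [← preimage_iUnion, hU, preimage_univ])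
  choose W hWo hW' using fun j => isOpen_induced_iff.1 (hW'o j)
  obtain rfl : (fun j => (↑) ⁻¹' W j) = W' := funext hW'
  have hcover : ⋃ j, U j ∩ (W j ∪ Fᶜ) = univ := by
    refine eq_univ_of_forall fun x => ?_
    by_cases hx : x ∈ F
    · obtain ⟨j, hj⟩ := mem_iUnion.1 (hW ▸ mem_univ (⟨x, hx⟩ : F))
      exact mem_iUnion.2 ⟨j, hWU j hj, Or.inl hj⟩
    · obtain ⟨j, hj⟩ := mem_iUnion.1 (hU ▸ mem_univ x)
      exact mem_iUnion.2 ⟨j, hj, Or.inr hx⟩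
  obtain ⟨V, hV, hVo, hVW⟩ := exists_iUnion_eq_closure_subset
    (fun j => (hUo j).inter ((hWo j).union hF.isOpen_compl)) (fun x => toFinite _) hcover
  refine ⟨V, hVo, hV, fun j => (hVW j).trans inter_subset_left, fun x hx => ?_⟩
  refine le_trans (encard_le_encard fun j hj => ?_) (hord ⟨x, hx⟩)
  exact (hVW j hj).2.resolve_right (not_not_intro hx)

theorem exists_isOpen_superset_iInter_eq_empty [NormalSpace X] {ι : Type*} [Finite ι]
    {K : ι → Set X} (hK : ∀ j, IsClosed (K j)) (hKe : ⋂ j, K j = ∅) :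
    ∃ G : ι → Set X, (∀ j, IsOpen (G j)) ∧ (∀ j, K j ⊆ G j) ∧ ⋂ j, G j = ∅ := by
  obtain ⟨V, hV, hVc, hVK⟩ := exists_iUnion_eq_closed_subset (fun j => (hK j).isOpen_compl)
    (fun x => toFinite _) (by rw [← compl_iInter, hKe, compl_empty])
  refine ⟨fun j => (V j)ᶜ, fun j => (hVc j).isOpen_compl, fun j => subset_compl_comm.1 (hVK j), ?_⟩
  rw [← compl_iUnion, hV, compl_univ]

theorem exists_isOpen_swelling [NormalSpace X] {ι : Type*} [Finite ι] {K : ι → Set X}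
    (hK : ∀ j, IsClosed (K j)) :
    ∃ G : ι → Set X, (∀ j, IsOpen (G j)) ∧ (∀ j, K j ⊆ G j) ∧
      ∀ S : Set ι, ⋂ j ∈ S, K j = ∅ → ⋂ j ∈ S, G j = ∅ := by
  have hswell : ∀ S : {S : Set ι // ⋂ j ∈ S, K j = ∅}, ∃ G : ι → Set X, (∀ j, IsOpen (G j)) ∧
      (∀ j, K j ⊆ G j) ∧ ⋂ j ∈ S.1, G j = ∅ := by
    rintro ⟨S, hS⟩
    -- Replacing `K j` by the whole space for `j ∉ S` reduces to an intersection over all of `ι`.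
    have hempty : ⋂ j, K j ∪ {_x | j ∉ S} = ∅ := by
      refine subset_empty_iff.1 (hS ▸ subset_iInter₂ fun j hj => ?_)
      exact (iInter_subset _ j).trans (union_subset Subset.rfl fun _ h => absurd hj h)
    obtain ⟨G, hGo, hKG, hG⟩ := exists_isOpen_superset_iInter_eq_empty
      (fun j => (hK j).union isClosed_const) hempty
    refine ⟨G, hGo, fun j => subset_union_left.trans (hKG j), subset_empty_iff.1 ?_⟩
    refine (subset_iInter fun j x hx => ?_).trans_eq hG
    by_cases hj : j ∈ S
    · exact mem_iInter₂.1 hx j hj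
    · exact hKG j (Or.inr hj)
  choose G hGo hKG hG using hswell
  refine ⟨fun j => ⋂ S, G S j, fun j => isOpen_iInter_of_finite fun S => hGo S j,
    fun j => subset_iInter fun S => hKG S j, fun S hS => subset_empty_iff.1 ?_⟩
  calc ⋂ j ∈ S, ⋂ S, G S j ⊆ ⋂ j ∈ S, G ⟨S, hS⟩ j := iInter₂_mono fun j _ => iInter_subset _ _
    _ = ∅ := hG ⟨S, hS⟩

theorem exists_isClosed_shrinking_of_iUnion [NormalSpace X] {F : ℕ → Set X}
    (hFc : ∀ i, IsClosed (F i)) (hF : ⋃ i, F i = univ) (hdim : ∀ i, CoveringDimLE (F i) n)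
    {ι : Type*} [Finite ι] {U : ι → Set X} (hUo : ∀ j, IsOpen (U j)) (hU : ⋃ j, U j = univ) :
    ∃ K : ι → Set X, (∀ j, IsClosed (K j)) ∧ (∀ j, K j ⊆ U j) ∧ ⋃ j, K j = univ ∧
      ∀ x, {j | x ∈ K j}.encard ≤ n + 1 := by
  -- Shrink the cover successively, lowering the order on `F i` at stage `i`. The closures are
  -- nested, so their intersections still cover, and their order is small on every `F i`.
  let P := {V : ι → Set X // (∀ j, IsOpen (V j)) ∧ ⋃ j, V j = univ}
  choose next hnexto hnext hnextV hnextord using fun (i : ℕ) (V : P) =>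
    (hdim i).exists_closure_shrinking (hFc i) V.2.1 V.2.2
  let s : ℕ → P := fun i =>
    Nat.rec ⟨U, hUo, hU⟩ (fun i V => ⟨next i V, hnexto i V, hnext i V⟩) i
  have hs : ∀ i j, closure ((s (i + 1)).1 j) ⊆ (s i).1 j := fun i => hnextV i (s i)
  have hanti : ∀ j, Antitone fun i => (s i).1 j := fun j =>
    antitone_nat_of_succ_le fun i => subset_closure.trans (hs i j)
  refine ⟨fun j => ⋂ i, closure ((s (i + 1)).1 j),
    fun j => isClosed_iInter fun i => isClosed_closure,
    fun j => (iInter_subset _ 0).trans (hs 0 j), ?_, fun x => ?_⟩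
  · rw [← iInter_iUnion_of_antitone fun j i k hik =>
      closure_mono (hanti j (Nat.succ_le_succ hik))]
    refine iInter_eq_univ.2 fun i => univ_subset_iff.1 ?_
    exact (s (i + 1)).2.2.ge.trans (iUnion_mono fun j => subset_closure)
  · obtain ⟨i, hi⟩ := mem_iUnion.1 (hF ▸ mem_univ x)
    exact le_trans (encard_le_encard fun j hj => mem_iInter.1 hj i) (hnextord i (s i) x hi)

theorem coveringDimLE_of_iUnion [NormalSpace X] {F : ℕ → Set X} (hFc : ∀ i, IsClosed (F i))
    (hF : ⋃ i, F i = univ) (hdim : ∀ i, CoveringDimLE (F i) n) : CoveringDimLE X n := by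
  refine coveringDimLE_of_forall_exists_shrinking fun ι _ U hUo hU => ?_
  obtain ⟨K, hKc, hKU, hK, hord⟩ := exists_isClosed_shrinking_of_iUnion hFc hF hdim hUo hU
  obtain ⟨G, hGo, hKG, hG⟩ := exists_isOpen_swelling hKc
  refine ⟨fun j => G j ∩ U j, fun j => (hGo j).inter (hUo j), fun j => inter_subset_right,
    univ_subset_iff.1 (hK.ge.trans (iUnion_mono fun j => subset_inter (hKG j) (hKU j))),
    fun x => ?_⟩
  obtain ⟨y, hy⟩ : (⋂ j ∈ {j | x ∈ G j}, K j).Nonempty := by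
    by_contra hempty
    have hx : x ∈ ⋂ j ∈ {j | x ∈ G j}, G j := mem_iInter₂.2 fun j hj => hj
    rwa [hG _ (not_nonempty_iff_eq_empty.1 hempty)] at hx
  exact (encard_le_encard fun j hj => mem_iInter₂.1 hy j hj.1).trans (hord y)

theorem IsSigmaClosedEmbeddable.coveringDimLE [NormalSpace X] (h : IsSigmaClosedEmbeddable X Y)
    (hY : CoveringDimLE Y n) : CoveringDimLE X n := by
  obtain ⟨A, hAc, hA, he⟩ := h
  exact coveringDimLE_of_iUnion hAc hA fun i =>
    (he i).elim fun _ hei => hY.of_isClosedEmbedding hei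

theorem IsSigmaClosedEmbeddable.coveringDim_le [NormalSpace X] (h : IsSigmaClosedEmbeddable X Y) :
    coveringDim X ≤ coveringDim Y := by
  refine sInf_le_sInf ?_
  rintro d (⟨hd, hY⟩ | ⟨n, hd, hY⟩)
  · obtain ⟨A, -, hA, he⟩ := h
    refine Or.inl ⟨hd, univ_eq_empty_iff.1 (hA ▸ iUnion_eq_empty.2 fun i => ?_)⟩
    exact (he i).elim fun e _ => isEmpty_coe_sort.1 (Function.isEmpty e)
  · exact Or.inr ⟨n, hd, h.coveringDimLE hY⟩

end CoveringDimension

theorem corollary3p9 (X : Type u) (Y : Type v) [TopologicalSpace X] [TopologicalSpace Y]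
    (hX : PerfectlyParacompact X) (hY : PerfectlyParacompact Y) (h : WeaklyHomeomorphic X Y) :
    Cardinal.lift.{v} (networkWeight X) = Cardinal.lift.{u} (networkWeight Y) ∧
    Cardinal.lift.{v} (hereditaryLindelofNumber X) =
      Cardinal.lift.{u} (hereditaryLindelofNumber Y) ∧
    Cardinal.lift.{v} (hereditaryDensity X) = Cardinal.lift.{u} (hereditaryDensity Y) ∧
    coveringDim X = coveringDim Y ∧
    (IsAnalyticSpace X ↔ IsAnalyticSpace Y) ∧
    (SigmaCompactSpace X ↔ SigmaCompactSpace Y) ∧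
    (IsSigmaPolish X ↔ IsSigmaPolish Y) := by
  have := hX.t2
  have := hX.paracompact
  have := hY.t2
  have := hY.paracompact
  have hXY := h.isSigmaClosedEmbeddable hX hY
  have hYX := h.symm.isSigmaClosedEmbeddable hY hX
  obtain ⟨f, -, -⟩ := h
  refine ⟨?_, ?_, ?_, ?_, ?_, ?_, ?_⟩
  · exact (hXY.lift_networkWeight_le f.injective).antisymm
      (hYX.lift_networkWeight_le f.symm.injective)
  · exact (hXY.lift_hereditaryLindelofNumber_le f.injective).antisymm
      (hYX.lift_hereditaryLindelofNumber_le f.symm.injective)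
  · exact (hXY.lift_hereditaryDensity_le f.injective).antisymm
      (hYX.lift_hereditaryDensity_le f.symm.injective)
  · exact hXY.coveringDim_le.antisymm hYX.coveringDim_le
  · exact ⟨hYX.isAnalyticSpace, hXY.isAnalyticSpace⟩
  · exact ⟨fun _ => hYX.sigmaCompactSpace, fun _ => hXY.sigmaCompactSpace⟩
  · exact ⟨hYX.isSigmaPolish, hXY.isSigmaPolish⟩
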